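/- Let $(W,S)$ be an arbitrary Coxeter system with length function $\ell$. A subset $I\subset S$ is called finitary if the subgroup $W_I=\langle I\rangle$ is finite; then $w_I$ denotes the longest element of $W_I$. For finitary $I,J\subset S$, an $(I,J)$-coset is an element $p$ of $W_I\backslash W/W_J$; write $\overline p$ and $\underline p$ for its unique elements of maximal and of minimal length. For $x,y\in W$ let $x*y$ be the product in the Coxeter monoid, that is, the associative product on $W$ with unit $1$ determined by $s*x=sx$ if $\ell(sx)>\ell(x)$ and $s*x=x$ otherwise, for $s\in S$, $x\in W$. For an $(I,J)$-coset $p$ and a $(J,K)$-coset $q$ put $p*q=W_I(\overline p*\overline q)W_K$, and call $p*q$ reduced if $\overline p*\overline q=(\overline p w_J^{-1})\,\overline q=\overline p\,(w_J^{-1}\overline q)$ and $\ell(\overline p*\overline q)=\ell(\overline p w_J^{-1})+\ell(\overline q)=\ell(\overline p)+\ell(w_J^{-1}\overline q)$. The nilCoxeter algebroid $\mathcal D=\mathcal D(W,S)$ is the $\mathbb Z$-linear category whose objects are the finitary subsets of $S$, in which $\operatorname{Hom}(J,I)$ is the free $\mathbb Z$-module with basis $\{\partial_p\}$, $p$ running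 over the $(I,J)$-cosets, and whose composition is the bilinear one with $\partial_p\circ\partial_q=\partial_{p*q}$ if $p*q$ is reduced and $\partial_p\circ\partial_q=0$ otherwise. The identity of $I$ is $\partial_p$ for the $(I,I)$-coset $p$ containing $1$. An $(I,J)$-coset $p$ is a core coset if $I\cap \underline p J\underline p^{-1}=I$ and $\underline p^{-1}I\underline p\cap J=J$. It is atomic if it is a core coset and there are $s\in S\setminus I$ and $t\in S\setminus J$ such that $K:=I\cup\{s\}=J\cup\{t\}$ is finitary and $\overline p=w_K$ (that is, $[I,K,J]$ is a reduced expression for $p$). Let $\mathcal{AD}\subset\mathcal D$ be the $\mathbb Z$-linear subcategory, with all objects of $\mathcal D$, generated by the morphisms $\partial_p$ for $p$ an atomic coset. **Theorem.** For all finitary $I,J\subset S$, the $\mathbb Z$-module $\operatorname{Hom}_{\mathcal{AD}}(J,I)$ is free with basis $\{\partial_p \mid p \text{ a core } (I,J)\text{-coset}\}$. -/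

import Mathlib

open CategoryTheory

namespace CoxeterSystem

variable {B W : Type*} [Group W] {M : CoxeterMatrix B} (cs : CoxeterSystem M W)

/-! ### The exchange property -/

open Classical in
/-- Auxiliary involution of `W × ZMod 2`, used for the exchange property. -/
noncomputable def signFun (i : B) : Function.End (W × ZMod 2) := fun x =>
  (cs.simple i * x.1 * cs.simple i, x.2 + if x.1 = cs.simple i then 1 else 0)

open Classical in
theorem signFun_pow (i j : B) (k : ℕ) (x : W × ZMod 2) :
    ((cs.signFun i * cs.signFun j) ^ k) x =
      ((cs.simple i * cs.simple j) ^ k * x.1 * ((cs.simple i * cs.simple j) ^ k)⁻¹,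
        x.2 + ∑ n ∈ Finset.range (2 * k),
          if x.1 = cs.simple j * (cs.simple i * cs.simple j) ^ n then 1 else 0) := by
  induction k with
  | zero => simp; rfl
  | succ k ih =>
    have hinv : ∀ n : ℕ, ((cs.simple i * cs.simple j) ^ n)⁻¹ * cs.simple j
        = cs.simple j * (cs.simple i * cs.simple j) ^ n := by
      intro n
      have h : SemiconjBy (cs.simple j) (cs.simple i * cs.simple j)
          (cs.simple i * cs.simple j)⁻¹ := by
        simp [SemiconjBy, mul_assoc]
      rw [← inv_pow]
      exact (h.pow_right n).symm
    rw [pow_succ']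
    change (cs.signFun i * cs.signFun j) (((cs.signFun i * cs.signFun j) ^ k) x) = _
    rw [ih]
    change cs.signFun i (cs.signFun j _) = _
    set c := cs.simple i * cs.simple j with hc
    have e1 : (c ^ k * x.1 * (c ^ k)⁻¹ = cs.simple j) ↔ x.1 = cs.simple j * c ^ (2 * k) := by
      rw [mul_inv_eq_iff_eq_mul, ← eq_inv_mul_iff_mul_eq, ← mul_assoc, hinv, mul_assoc, ← pow_add,
        two_mul]
    have e2 : (cs.simple j * (c ^ k * x.1 * (c ^ k)⁻¹) * cs.simple j = cs.simple i) ↔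
        x.1 = cs.simple j * c ^ (2 * k + 1) := by
      have : cs.simple j * (c ^ k * x.1 * (c ^ k)⁻¹) * cs.simple j = cs.simple i ↔
          c ^ k * x.1 * (c ^ k)⁻¹ = cs.simple j * c := by
        generalize c ^ k * x.1 * (c ^ k)⁻¹ = y
        rw [hc]
        constructor
        · intro h
          rw [← h]; simp [mul_assoc]
        · intro h
          rw [h]; simp [mul_assoc]
      rw [this, mul_inv_eq_iff_eq_mul, ← eq_inv_mul_iff_mul_eq, ← mul_assoc, ← mul_assoc, hinv,
        mul_assoc, mul_assoc, ← pow_succ', ← pow_add]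
      ring_nf
    ext
    · simp [signFun, hc, pow_succ', mul_assoc]
    · simp only [signFun, e1, e2]
      rw [show 2 * (k + 1) = 2 * k + 1 + 1 by ring, Finset.sum_range_succ, Finset.sum_range_succ]
      ring

theorem signFun_isLiftable : M.IsLiftable cs.signFun := by
  classical
  intro i j
  funext x
  rw [signFun_pow, two_mul, Finset.sum_range_add]
  simp only [pow_add, simple_mul_simple_pow, one_mul]
  ext
  · simp; rfl
  · simp [CharTwo.add_self_eq_zero]; rfl

open Classical in
theorem lift_signFun_wordProd (ω : List B) (x : W × ZMod 2) :
    cs.lift ⟨cs.signFun, cs.signFun_isLiftable⟩ (cs.wordProd ω) x =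
      (cs.wordProd ω * x.1 * (cs.wordProd ω)⁻¹,
        x.2 + ((cs.rightInvSeq ω).count x.1 : ℕ)) := by
  induction ω with
  | nil => simp; rfl
  | cons i ω ih =>
    rw [wordProd_cons, map_mul, lift_apply_simple]
    change cs.signFun i _ = _
    rw [ih, rightInvSeq, List.count_cons]
    have : (cs.wordProd ω * x.1 * (cs.wordProd ω)⁻¹ = cs.simple i) ↔
        (cs.wordProd ω)⁻¹ * cs.simple i * cs.wordProd ω = x.1 := by
      rw [mul_inv_eq_iff_eq_mul, ← eq_inv_mul_iff_mul_eq, eq_comm, mul_assoc]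
    ext
    · simp [signFun, mul_assoc]
    · simp only [signFun, this, beq_iff_eq]
      push_cast
      ring

theorem exchange_right (ω : List B) (i : B)
    (h : cs.length (cs.wordProd ω * cs.simple i) < cs.length (cs.wordProd ω)) :
    ∃ j < ω.length, cs.wordProd ω * cs.simple i = cs.wordProd (ω.eraseIdx j) := by
  classical
  obtain ⟨ω', hω', hw⟩ := cs.exists_isReduced (cs.wordProd ω * cs.simple i)
  have hp : cs.wordProd (ω' ++ [i]) = cs.wordProd ω := by
    rw [wordProd_append, ← hw]; simp
  have hr : cs.IsReduced (ω' ++ [i]) := by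
    unfold IsReduced
    rw [hp]
    have := (cs.isRightDescent_iff).1 h
    rw [hw, hω'.eq] at this
    simp [← this]
  have hmem : cs.simple i ∈ cs.rightInvSeq (ω' ++ [i]) := by
    rw [← List.concat_eq_append, rightInvSeq_concat]; simp
  have hc : (cs.rightInvSeq (ω' ++ [i])).count (cs.simple i) = 1 :=
    List.count_eq_one_of_mem hr.nodup_rightInvSeq hmem
  have h1 := cs.lift_signFun_wordProd (ω' ++ [i]) (cs.simple i, 0)
  rw [hp, lift_signFun_wordProd, hc] at h1
  have h2 : (((cs.rightInvSeq ω).count (cs.simple i) : ℕ) : ZMod 2) = 1 := by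
    simpa using congrArg Prod.snd h1
  have hmem' : cs.simple i ∈ cs.rightInvSeq ω := by
    by_contra hn
    rw [List.count_eq_zero_of_not_mem hn] at h2
    simp at h2
  obtain ⟨j, hj, hji⟩ := List.getElem_of_mem hmem'
  refine ⟨j, by simpa using hj, ?_⟩
  rw [← wordProd_mul_getD_rightInvSeq, List.getD_eq_getElem _ _ hj, hji]

theorem exists_reduced_subset (ω : List B) :
    ∃ ω' : List B, ω' ⊆ ω ∧ cs.IsReduced ω' ∧ cs.wordProd ω' = cs.wordProd ω := by
  induction ω using List.reverseRecOn with
  | nil => exact ⟨[], by simp, by simp [IsReduced], rfl⟩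
  | append_singleton ω i ih =>
    obtain ⟨ω', h1, h2, h3⟩ := ih
    rcases cs.length_mul_simple (cs.wordProd ω') i with h | h
    · refine ⟨ω' ++ [i], ?_, ?_, ?_⟩
      · simp only [List.append_subset, List.subset_append_right, and_true]
        exact fun x hx => List.mem_append_left _ (h1 hx)
      · simp [IsReduced, wordProd_append, h, h2.eq]
      · simp [wordProd_append, h3]
    · obtain ⟨j, hj, he⟩ := cs.exchange_right ω' i (by omega)
      refine ⟨ω'.eraseIdx j, ?_, ?_, ?_⟩
      · exact fun x hx => List.mem_append_left _ (h1 (List.mem_of_mem_eraseIdx hx))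
      · have := List.length_eraseIdx_of_lt hj
        have h4 := h2.eq
        unfold IsReduced
        rw [← he]; omega
      · rw [← he, wordProd_append, h3]; simp

/-! ### The Coxeter monoid -/

/-- The operator `x ↦ s * x` of the Coxeter monoid, for a simple reflection `s`: it is `sx` if
`ℓ(sx) > ℓ(x)`, and `x` otherwise. -/
noncomputable def leftStar (s x : W) : W := if cs.length x < cs.length (s * x) then s * x else x

/-- The mirror image of `leftStar`. -/
noncomputable def rightStar (x s : W) : W := if cs.length x < cs.length (x * s) then x * s else x

/-- The product of the Coxeter monoid (0-Hecke monoid, star monoid) `(W, *)`, transported to `W`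
along the identification by reduced expressions: if `s₁ ⋯ sₖ` is a reduced expression of `x` then
`x * y = s₁ * (s₂ * (⋯ (sₖ * y)))`. It does not depend on the reduced expression, by
`star_eq_foldr`. -/
noncomputable def star (x y : W) : W :=
  (cs.exists_isReduced x).choose.foldr (fun i z => cs.leftStar (cs.simple i) z) y

theorem leftStar_rightStar (i j : B) (w : W) :
    cs.leftStar (cs.simple i) (cs.rightStar w (cs.simple j)) =
      cs.rightStar (cs.leftStar (cs.simple i) w) (cs.simple j) := by
  have key : cs.length w < cs.length (cs.simple i * w) →
      cs.length w < cs.length (w * cs.simple j) →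
      cs.length (cs.simple i * w * cs.simple j) < cs.length (cs.simple i * w) →
      cs.simple i * w = w * cs.simple j := by
    intro h1 h2 h3
    obtain ⟨ω, hω, rfl⟩ := cs.exists_isReduced w
    obtain ⟨k, hk, he⟩ := cs.exchange_right (i :: ω) j (by simpa [wordProd_cons] using h3)
    cases k with
    | zero =>
      rw [wordProd_cons] at he
      simp only [List.eraseIdx_zero, List.tail_cons] at he
      generalize cs.wordProd ω = w at he
      nth_rewrite 2 [← he]
      simp [mul_assoc]
    | succ k =>
      exfalso
      simp only [List.eraseIdx_cons_succ, wordProd_cons, mul_assoc, mul_right_inj] at he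
      have h4 := cs.length_wordProd_le (ω.eraseIdx k)
      have h5 := List.length_eraseIdx_of_lt (l := ω) (i := k) (by simpa using hk)
      rw [← he] at h4
      have := hω.eq
      simp at hk
      omega
  have a1 := cs.length_simple_mul w i
  have a2 := cs.length_mul_simple w j
  have a3 := cs.length_mul_simple (cs.simple i * w) j
  have a4 := cs.length_simple_mul (w * cs.simple j) i
  rw [← mul_assoc] at a4
  unfold leftStar rightStar
  split_ifs <;> simp only [mul_assoc] at * <;> first
    | rfl
    | (exfalso; omega)
    | exact (key (by omega) (by omega) (by omega)).symm

theorem foldr_rightStar (ω : List B) (j : B) (w : W) :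
    ω.foldr (fun i z => cs.leftStar (cs.simple i) z) (cs.rightStar w (cs.simple j)) =
      cs.rightStar (ω.foldr (fun i z => cs.leftStar (cs.simple i) z) w) (cs.simple j) := by
  induction ω with
  | nil => rfl
  | cons i ω ih => simp only [List.foldr_cons, ih, leftStar_rightStar]

theorem foldr_foldl (ω ω' : List B) (w : W) :
    ω.foldr (fun i z => cs.leftStar (cs.simple i) z)
        (ω'.foldl (fun z i => cs.rightStar z (cs.simple i)) w) =
      ω'.foldl (fun z i => cs.rightStar z (cs.simple i))
        (ω.foldr (fun i z => cs.leftStar (cs.simple i) z) w) := by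
  induction ω' generalizing w with
  | nil => rfl
  | cons i ω' ih => simp only [List.foldl_cons, ih, foldr_rightStar]

theorem foldr_one {ω : List B} (h : cs.IsReduced ω) :
    ω.foldr (fun i z => cs.leftStar (cs.simple i) z) 1 = cs.wordProd ω := by
  induction ω with
  | nil => simp
  | cons i ω ih =>
    have h' : cs.IsReduced ω := by simpa using h.drop 1
    rw [List.foldr_cons, ih h', wordProd_cons, leftStar, if_pos]
    have := h.eq
    rw [wordProd_cons, List.length_cons] at this
    rw [this, h'.eq]; omega

theorem foldl_one {ω : List B} (h : cs.IsReduced ω) :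
    ω.foldl (fun z i => cs.rightStar z (cs.simple i)) 1 = cs.wordProd ω := by
  induction ω using List.reverseRecOn with
  | nil => simp
  | append_singleton ω i ih =>
    have h' : cs.IsReduced ω := by simpa using h.take ω.length
    rw [List.foldl_append, ih h', wordProd_append]
    simp only [List.foldl_cons, List.foldl_nil, wordProd_singleton]
    rw [rightStar, if_pos]
    have := h.eq
    rw [wordProd_append, List.length_append, wordProd_singleton] at this
    rw [this, h'.eq]; simp

/-- The star product may be computed by any word whose star product is `x`. -/
theorem star_foldr (ω : List B) (y : W) :
    cs.star (ω.foldr (fun i z => cs.leftStar (cs.simple i) z) 1) y =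
      ω.foldr (fun i z => cs.leftStar (cs.simple i) z) y := by
  obtain ⟨ω', h, rfl⟩ := cs.exists_isReduced y
  rw [← foldl_one cs h, foldr_foldl, star, foldr_foldl]
  have := (cs.exists_isReduced (ω.foldr (fun i z => cs.leftStar (cs.simple i) z) 1)).choose_spec
  rw [foldr_one cs this.1, ← this.2]

theorem star_eq_foldr {ω : List B} (h : cs.IsReduced ω) (y : W) :
    cs.star (cs.wordProd ω) y = ω.foldr (fun i z => cs.leftStar (cs.simple i) z) y := by
  rw [← star_foldr, foldr_one cs h]

theorem star_eq_foldl (x : W) {ω : List B} (h : cs.IsReduced ω) :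
    cs.star x (cs.wordProd ω) = ω.foldl (fun z i => cs.rightStar z (cs.simple i)) x := by
  obtain ⟨ω', h', rfl⟩ := cs.exists_isReduced x
  rw [star_eq_foldr cs h', ← foldl_one cs h, foldr_foldl, foldr_one cs h']

theorem star_one (x : W) : cs.star x 1 = x := by
  simpa using cs.star_eq_foldl x (ω := []) (by simp [IsReduced])

theorem one_star (x : W) : cs.star 1 x = x := by
  simpa using cs.star_eq_foldr (ω := []) (by simp [IsReduced]) x

theorem simple_star (i : B) (x : W) : cs.star (cs.simple i) x = cs.leftStar (cs.simple i) x := by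
  simpa using cs.star_eq_foldr (ω := [i]) (by simp [IsReduced]) x

theorem star_simple (x : W) (i : B) : cs.star x (cs.simple i) = cs.rightStar x (cs.simple i) := by
  simpa using cs.star_eq_foldl x (ω := [i]) (by simp [IsReduced])

theorem star_assoc (x y z : W) : cs.star (cs.star x y) z = cs.star x (cs.star y z) := by
  obtain ⟨ω, h, rfl⟩ := cs.exists_isReduced x
  obtain ⟨ω', h', rfl⟩ := cs.exists_isReduced y
  rw [star_eq_foldr cs h, star_eq_foldr cs h, star_eq_foldr cs h', ← List.foldr_append,
    ← star_foldr cs (ω ++ ω'), List.foldr_append, foldr_one cs h']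

theorem length_foldr_le (ω : List B) (y : W) :
    cs.length (ω.foldr (fun i z => cs.leftStar (cs.simple i) z) y) ≤ ω.length + cs.length y := by
  induction ω with
  | nil => simp
  | cons i ω ih =>
    simp only [List.foldr_cons, List.length_cons]
    set z := ω.foldr (fun i z => cs.leftStar (cs.simple i) z) y
    have := cs.length_simple_mul z i
    unfold leftStar
    split_ifs <;> omega

theorem foldr_eq_of_length (ω : List B) (y : W)
    (h : cs.length (ω.foldr (fun i z => cs.leftStar (cs.simple i) z) y) =
      ω.length + cs.length y) :
    ω.foldr (fun i z => cs.leftStar (cs.simple i) z) y = cs.wordProd ω * y := by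
  induction ω with
  | nil => simp
  | cons i ω ih =>
    simp only [List.foldr_cons, List.length_cons] at h ⊢
    have h1 := cs.length_foldr_le ω y
    set z := ω.foldr (fun i z => cs.leftStar (cs.simple i) z) y
    have := cs.length_simple_mul z i
    unfold leftStar at h ⊢
    split_ifs at h ⊢ with hh
    · rw [ih (by omega), wordProd_cons, mul_assoc]
    · omega

theorem foldr_eq_of_reduced (ω : List B) (y : W)
    (h : cs.length (cs.wordProd ω * y) = ω.length + cs.length y) :
    ω.foldr (fun i z => cs.leftStar (cs.simple i) z) y = cs.wordProd ω * y := by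
  induction ω with
  | nil => simp
  | cons i ω ih =>
    simp only [List.foldr_cons, List.length_cons, wordProd_cons, mul_assoc] at h ⊢
    have h1 := cs.length_mul_le (cs.wordProd ω) y
    have h2 := cs.length_wordProd_le ω
    have := cs.length_simple_mul (cs.wordProd ω * y) i
    rw [ih (by omega), leftStar, if_pos (by omega)]

theorem length_star_le (x y : W) : cs.length (cs.star x y) ≤ cs.length x + cs.length y := by
  obtain ⟨ω, h, rfl⟩ := cs.exists_isReduced x
  rw [star_eq_foldr cs h, h.eq]
  exact cs.length_foldr_le ω y

/-- A star product of maximal length is the product in `W`. -/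
theorem star_eq_mul_of_length_star {x y : W}
    (h : cs.length (cs.star x y) = cs.length x + cs.length y) : cs.star x y = x * y := by
  obtain ⟨ω, hω, rfl⟩ := cs.exists_isReduced x
  rw [star_eq_foldr cs hω, hω.eq] at h
  rw [star_eq_foldr cs hω]
  exact cs.foldr_eq_of_length ω y h

/-- Reduced products in `W` and in the Coxeter monoid agree. -/
theorem star_eq_mul {x y : W}
    (h : cs.length (x * y) = cs.length x + cs.length y) : cs.star x y = x * y := by
  obtain ⟨ω, hω, rfl⟩ := cs.exists_isReduced x
  rw [hω.eq] at h
  rw [star_eq_foldr cs hω]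
  exact cs.foldr_eq_of_reduced ω y h

/-! ### Finitary subsets and longest elements -/

/-- A finitary subset of the set `S` of simple reflections: a subset `I ⊆ S` such that the
parabolic subgroup `W_I` generated by `I` is finite. -/
@[ext]
structure FinitarySubset where
  /-- the underlying set of simple reflections -/
  carrier : Set W
  subset_simple : carrier ⊆ Set.range cs.simple
  finite_parabolic : Finite (Subgroup.closure carrier)

namespace FinitarySubset

variable {cs}

/-- The parabolic subgroup `W_I`. -/
def parabolic (I : cs.FinitarySubset) : Subgroup W := Subgroup.closure I.carrier

theorem exists_longest (I : cs.FinitarySubset) :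
    ∃ w ∈ I.parabolic, ∀ x ∈ I.parabolic, cs.length x ≤ cs.length w := by
  have : Finite I.parabolic := I.finite_parabolic
  obtain ⟨w, hw⟩ := Finite.exists_max (fun x : I.parabolic => cs.length x.1)
  exact ⟨w.1, w.2, fun x hx => hw ⟨x, hx⟩⟩

/-- The longest element `w_I` of `W_I`. -/
noncomputable def longest (I : cs.FinitarySubset) : W := I.exists_longest.choose

theorem longest_mem (I : cs.FinitarySubset) : I.longest ∈ I.parabolic :=
  I.exists_longest.choose_spec.1

theorem length_le_longest (I : cs.FinitarySubset) {x : W} (hx : x ∈ I.parabolic) :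
    cs.length x ≤ cs.length I.longest :=
  I.exists_longest.choose_spec.2 x hx

theorem mem_parabolic (I : cs.FinitarySubset) {s : W} (hs : s ∈ I.carrier) : s ∈ I.parabolic :=
  Subgroup.subset_closure hs

theorem exists_word (I : cs.FinitarySubset) {x : W} (hx : x ∈ I.parabolic) :
    ∃ ω : List B, (∀ i ∈ ω, cs.simple i ∈ I.carrier) ∧ cs.IsReduced ω ∧ cs.wordProd ω = x := by
  suffices h : ∃ ω : List B, (∀ i ∈ ω, cs.simple i ∈ I.carrier) ∧ cs.wordProd ω = x by
    obtain ⟨ω, h1, h2⟩ := h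
    obtain ⟨ω', h3, h4, h5⟩ := cs.exists_reduced_subset ω
    exact ⟨ω', fun i hi => h1 i (h3 hi), h4, h5.trans h2⟩
  refine Subgroup.closure_induction (p := fun x _ => ∃ ω : List B,
    (∀ i ∈ ω, cs.simple i ∈ I.carrier) ∧ cs.wordProd ω = x) ?_ ⟨[], by simp⟩ ?_ ?_ hx
  · intro s hs
    obtain ⟨i, rfl⟩ := I.subset_simple hs
    exact ⟨[i], by simpa using hs, by simp⟩
  · rintro x y _ _ ⟨ω, h1, rfl⟩ ⟨ω', h2, rfl⟩
    refine ⟨ω ++ ω', ?_, by simp [wordProd_append]⟩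
    intro i hi
    rcases List.mem_append.1 hi with hi | hi
    exacts [h1 i hi, h2 i hi]
  · rintro x _ ⟨ω, h1, rfl⟩
    exact ⟨ω.reverse, by simpa using h1, by simp⟩

theorem star_eq_right (I : cs.FinitarySubset) {x u : W} (hx : x ∈ I.parabolic)
    (hu : ∀ s ∈ I.carrier, cs.length (s * u) ≤ cs.length u) : cs.star x u = u := by
  obtain ⟨ω, h1, h2, rfl⟩ := I.exists_word hx
  rw [star_eq_foldr cs h2]
  clear h2 hx
  induction ω with
  | nil => rfl
  | cons i ω ih =>
    rw [List.foldr_cons, ih (fun j hj => h1 j (List.mem_cons_of_mem _ hj)), leftStar, if_neg]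
    exact not_lt.2 (hu _ (h1 i (by simp)))

theorem star_eq_left (I : cs.FinitarySubset) {x u : W} (hx : x ∈ I.parabolic)
    (hu : ∀ s ∈ I.carrier, cs.length (u * s) ≤ cs.length u) : cs.star u x = u := by
  obtain ⟨ω, h1, h2, rfl⟩ := I.exists_word hx
  rw [star_eq_foldl cs _ h2]
  clear h2 hx
  induction ω with
  | nil => rfl
  | cons i ω ih =>
    rw [List.foldl_cons, rightStar, if_neg, ih (fun j hj => h1 j (List.mem_cons_of_mem _ hj))]
    exact not_lt.2 (hu _ (h1 i (by simp)))

theorem longest_star_mul (I : cs.FinitarySubset) {a : W} (ha : a ∈ I.parabolic) (y : W) :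
    cs.star I.longest (a * y) = cs.star I.longest y := by
  refine Subgroup.closure_induction (p := fun a _ => ∀ y,
    cs.star I.longest (a * y) = cs.star I.longest y) ?_ (by simp) ?_ ?_ ha y
  · intro s hs y
    have h0 : cs.star I.longest s = I.longest := I.star_eq_left (I.mem_parabolic hs)
      fun t ht => I.length_le_longest (mul_mem I.longest_mem (I.mem_parabolic ht))
    obtain ⟨i, rfl⟩ := I.subset_simple hs
    have h1 := cs.length_simple_mul y i
    rcases h1 with h1 | h1
    · rw [← h0, star_assoc, star_assoc, simple_star cs i y, leftStar, if_pos (by omega),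
        simple_star, leftStar, if_neg (by simp [h1])]
    · nth_rewrite 2 [← h0]
      rw [star_assoc, simple_star cs i y, leftStar, if_neg (by omega)]
      nth_rewrite 1 [← h0]
      rw [star_assoc, simple_star, leftStar, if_pos (by simp; omega)]
      simp
  · intro a b _ _ h1 h2 y
    rw [mul_assoc, h1, h2]
  · intro a _ h y
    rw [← h (a⁻¹ * y), mul_inv_cancel_left]

theorem star_longest_mul (I : cs.FinitarySubset) {a : W} (ha : a ∈ I.parabolic) (y : W) :
    cs.star (y * a) I.longest = cs.star y I.longest := by
  refine Subgroup.closure_induction (p := fun a _ => ∀ y,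
    cs.star (y * a) I.longest = cs.star y I.longest) ?_ (by simp) ?_ ?_ ha y
  · intro s hs y
    have h0 : cs.star s I.longest = I.longest := I.star_eq_right (I.mem_parabolic hs)
      fun t ht => I.length_le_longest (mul_mem (I.mem_parabolic ht) I.longest_mem)
    obtain ⟨i, rfl⟩ := I.subset_simple hs
    have h1 := cs.length_mul_simple y i
    rcases h1 with h1 | h1
    · rw [← h0, ← star_assoc, ← star_assoc, star_simple cs y i, rightStar, if_pos (by omega),
        star_simple, rightStar, if_neg (by simp [h1])]
    · nth_rewrite 2 [← h0]
      rw [← star_assoc, star_simple cs y i, rightStar, if_neg (by omega)]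
      nth_rewrite 1 [← h0]
      rw [← star_assoc, star_simple, rightStar, if_pos (by simp; omega)]
      simp
  · intro a b _ _ h1 h2 y
    rw [← mul_assoc, h2, h1]
  · intro a _ h y
    rw [← h (y * a⁻¹), inv_mul_cancel_right]

theorem length_mul_longest (I : cs.FinitarySubset) {x u : W} (hu : u ∈ I.parabolic)
    (hu' : ∀ y ∈ I.parabolic, cs.length y ≤ cs.length u)
    (hx : ∀ s ∈ I.carrier, cs.length (x * s) ≤ cs.length x) :
    cs.length (x * u⁻¹) + cs.length u = cs.length x := by
  have : Finite I.parabolic := I.finite_parabolic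
  obtain ⟨v, hv⟩ := Finite.exists_min (fun v : I.parabolic => cs.length (x * v.1))
  set y := x * v.1 with hy
  have hmin : ∀ a ∈ I.parabolic, cs.length y ≤ cs.length (y * a) := fun a ha => by
    rw [hy, mul_assoc]; exact hv ⟨v.1 * a, mul_mem v.2 ha⟩
  have hadd : ∀ a ∈ I.parabolic, cs.length (y * a) = cs.length y + cs.length a := by
    intro a ha
    obtain ⟨ω, h1, h2, rfl⟩ := I.exists_word ha
    clear ha
    induction ω using List.reverseRecOn with
    | nil => simp
    | append_singleton ω i ih =>
      have h2' : cs.IsReduced ω := by simpa using h2.take ω.length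
      have h1' : ∀ j ∈ ω, cs.simple j ∈ I.carrier := fun j hj => h1 j (List.mem_append_left _ hj)
      have ih := ih h1' h2'
      have hωm : ∀ ω' : List B, ω' ⊆ ω → cs.wordProd ω' ∈ I.parabolic := fun ω' hω' => by
        refine list_prod_mem ?_
        intro z hz
        obtain ⟨j, hj, rfl⟩ := List.mem_map.1 hz
        exact I.mem_parabolic (h1' j (hω' hj))
      have hlen := h2.eq
      rw [wordProd_append, wordProd_singleton, List.length_append, List.length_singleton] at hlen
      rw [wordProd_append, wordProd_singleton, ← mul_assoc, hlen]
      have h2e := h2'.eq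
      rcases cs.length_mul_simple (y * cs.wordProd ω) i with h | h
      · omega
      · exfalso
        obtain ⟨τ, hτ, hτy⟩ := cs.exists_isReduced y
        have hτe := hτ.eq
        obtain ⟨k, hk, he⟩ := cs.exchange_right (τ ++ ω) i (by
          rw [wordProd_append, ← hτy]; omega)
        rw [wordProd_append, ← hτy] at he
        rcases lt_or_ge k τ.length with hk' | hk'
        · rw [List.eraseIdx_append_of_lt_length hk', wordProd_append] at he
          have h5 := hmin (cs.wordProd ω * cs.simple i * (cs.wordProd ω)⁻¹)
            (mul_mem (mul_mem (hωm ω (by simp)) (I.mem_parabolic (h1 i (by simp))))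
              (inv_mem (hωm ω (by simp))))
          rw [← mul_assoc, ← mul_assoc, he, mul_inv_cancel_right] at h5
          have h6 := cs.length_wordProd_le (τ.eraseIdx k)
          rw [List.length_eraseIdx_of_lt hk'] at h6
          rw [hτy] at h5
          omega
        · rw [List.eraseIdx_append_of_length_le hk', wordProd_append, ← hτy, mul_assoc,
            mul_right_inj] at he
          have h6 := cs.length_wordProd_le (ω.eraseIdx (k - τ.length))
          rw [List.length_append] at hk
          rw [← he, List.length_eraseIdx_of_lt (by omega)] at h6
          omega
  have hxv : x = y * v.1⁻¹ := by simp [hy]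
  have hvu : v.1⁻¹ = u := by
    have e1 : cs.star v.1⁻¹ u = u := I.star_eq_right (inv_mem v.2)
      fun s hs => hu' _ (mul_mem (I.mem_parabolic hs) hu)
    have e2 : cs.star v.1⁻¹ u = v.1⁻¹ := I.star_eq_left hu fun s hs => by
      have := hx s hs
      rw [hxv, mul_assoc, hadd _ (mul_mem (inv_mem v.2) (I.mem_parabolic hs)),
        hadd _ (inv_mem v.2)] at this
      omega
    rw [← e2, e1]
  rw [hxv, hvu, mul_inv_cancel_right, hadd u hu]

theorem length_longest_mul (I : cs.FinitarySubset) {x : W}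
    (hx : ∀ s ∈ I.carrier, cs.length (s * x) ≤ cs.length x) :
    cs.length (I.longest⁻¹ * x) + cs.length I.longest = cs.length x := by
  have := I.length_mul_longest (x := x⁻¹) (u := I.longest⁻¹) (inv_mem I.longest_mem)
    (fun y hy => by rw [length_inv]; exact I.length_le_longest hy) (fun s hs => by
      obtain ⟨i, rfl⟩ := I.subset_simple hs
      rw [← cs.inv_simple i, ← mul_inv_rev, length_inv, length_inv]
      exact hx _ hs)
  rw [← mul_inv_rev, length_inv, length_inv, length_inv] at this
  exact this

end FinitarySubset

/-! ### Double cosets -/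

variable {cs}

/-- The set `W_I \ W / W_J` of `(I, J)`-cosets. -/
abbrev Coset (I J : cs.FinitarySubset) : Type _ :=
  DoubleCoset.Quotient (I.parabolic : Set W) (J.parabolic : Set W)

namespace Coset

variable {I J K L : cs.FinitarySubset}

/-- The underlying subset of `W` of an `(I, J)`-coset. -/
def elements (p : Coset I J) : Set W := {x | DoubleCoset.mk I.parabolic J.parabolic x = p}

theorem mk_eq_mk {x y : W} :
    DoubleCoset.mk I.parabolic J.parabolic x = DoubleCoset.mk I.parabolic J.parabolic y ↔
      ∃ a ∈ I.parabolic, ∃ b ∈ J.parabolic, y = a * x * b :=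
  Quotient.eq''.trans DoubleCoset.rel_iff

theorem nonempty_elements (p : Coset I J) : p.elements.Nonempty := by
  induction p using Quotient.inductionOn' with
  | h x => exact ⟨x, rfl⟩

theorem finite_elements (p : Coset I J) : p.elements.Finite := by
  obtain ⟨x, rfl⟩ := p.nonempty_elements
  have h1 : (I.parabolic : Set W).Finite := I.finite_parabolic
  have h2 : (J.parabolic : Set W).Finite := J.finite_parabolic
  refine (h1.image2 (fun a b => a * x * b) h2).subset fun y hy => ?_
  obtain ⟨a, ha, b, hb, h⟩ := mk_eq_mk.1 (Eq.symm hy)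
  exact ⟨a, ha, b, hb, h.symm⟩

theorem exists_maxElt (p : Coset I J) :
    ∃ x ∈ p.elements, ∀ y ∈ p.elements, cs.length y ≤ cs.length x :=
  Set.exists_max_image _ cs.length p.finite_elements p.nonempty_elements

theorem exists_minElt (p : Coset I J) :
    ∃ x ∈ p.elements, ∀ y ∈ p.elements, cs.length x ≤ cs.length y :=
  Set.exists_min_image _ cs.length p.finite_elements p.nonempty_elements

/-- The maximal element of a double coset, i.e. its unique element of maximal length. -/
noncomputable def maxElt (p : Coset I J) : W := p.exists_maxElt.choose

/-- The minimal element of a double coset, i.e. its unique element of minimal length. -/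
noncomputable def minElt (p : Coset I J) : W := p.exists_minElt.choose

/-- The left redundancy `I ∩ x J x⁻¹`, where `x` is the minimal element of `p`. -/
def leftRed (p : Coset I J) : Set W :=
  I.carrier ∩ (fun t => p.minElt * t * p.minElt⁻¹) '' J.carrier

/-- The right redundancy `x⁻¹ I x ∩ J`, where `x` is the minimal element of `p`. -/
def rightRed (p : Coset I J) : Set W :=
  (fun s => p.minElt⁻¹ * s * p.minElt) '' I.carrier ∩ J.carrier

/-- Core cosets. -/
def IsCore (p : Coset I J) : Prop := p.leftRed = I.carrier ∧ p.rightRed = J.carrier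

/-- `p` has the reduced expression `[I, K, J]`, where `I ⊆ K ⊇ J`. -/
def HasReducedExpr (p : Coset I J) (K : cs.FinitarySubset) : Prop :=
  I.carrier ⊆ K.carrier ∧ J.carrier ⊆ K.carrier ∧
    p.maxElt = K.longest ∧ cs.length p.maxElt = cs.length K.longest

/-- Atomic cosets: core cosets with a reduced expression `[I + s - t] = [I, K, J]`, where
`K = I ⊔ {s} = J ⊔ {t}`. -/
def IsAtomic (p : Coset I J) : Prop :=
  p.IsCore ∧ ∃ (K : cs.FinitarySubset) (s t : W), s ∉ I.carrier ∧ t ∉ J.carrier ∧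
    K.carrier = insert s I.carrier ∧ K.carrier = insert t J.carrier ∧ p.HasReducedExpr K

/-- The composition `p * q = W_I (p̄ * q̄) W_K` of the singular Coxeter monoid. -/
noncomputable def star (p : Coset I J) (q : Coset J K) : Coset I K :=
  DoubleCoset.mk _ _ (cs.star p.maxElt q.maxElt)

/-- `x . y = z`, i.e. `z = xy` with `ℓ(z) = ℓ(x) + ℓ(y)`. -/
def IsReducedMul (cs : CoxeterSystem M W) (x y z : W) : Prop :=
  x * y = z ∧ cs.length z = cs.length x + cs.length y

/-- The composition `p * q` is reduced: `(p̄ w_J⁻¹) . q̄ = p̄ * q̄ = p̄ . (w_J⁻¹ q̄)`. -/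
def IsReducedComp (p : Coset I J) (q : Coset J K) : Prop :=
  IsReducedMul cs (p.maxElt * J.longest⁻¹) q.maxElt (cs.star p.maxElt q.maxElt) ∧
    IsReducedMul cs p.maxElt (J.longest⁻¹ * q.maxElt) (cs.star p.maxElt q.maxElt)

/-- The identity `(I, I)`-coset. -/
def one (I : cs.FinitarySubset) : Coset I I := DoubleCoset.mk _ _ 1

theorem mk_maxElt (p : Coset I J) : DoubleCoset.mk _ _ p.maxElt = p :=
  p.exists_maxElt.choose_spec.1

theorem length_le_maxElt (p : Coset I J) {x : W} (hx : DoubleCoset.mk _ _ x = p) :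
    cs.length x ≤ cs.length p.maxElt :=
  p.exists_maxElt.choose_spec.2 x hx

theorem maxElt_left (p : Coset I J) {s : W} (hs : s ∈ I.carrier) :
    cs.length (s * p.maxElt) ≤ cs.length p.maxElt := by
  apply p.length_le_maxElt
  conv_rhs => rw [← p.mk_maxElt]
  exact (mk_eq_mk.2 ⟨s, I.mem_parabolic hs, 1, one_mem _, by simp⟩).symm

theorem maxElt_right (p : Coset I J) {s : W} (hs : s ∈ J.carrier) :
    cs.length (p.maxElt * s) ≤ cs.length p.maxElt := by
  apply p.length_le_maxElt
  conv_rhs => rw [← p.mk_maxElt]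
  exact (mk_eq_mk.2 ⟨1, one_mem _, s, J.mem_parabolic hs, by simp⟩).symm

theorem longest_star_maxElt (p : Coset I J) : cs.star I.longest p.maxElt = p.maxElt :=
  I.star_eq_right I.longest_mem fun _ hs => p.maxElt_left hs

theorem maxElt_star_longest (p : Coset I J) : cs.star p.maxElt J.longest = p.maxElt :=
  J.star_eq_left J.longest_mem fun _ hs => p.maxElt_right hs

theorem eq_maxElt {x : W} (p : Coset I J) (hx : DoubleCoset.mk _ _ x = p)
    (h1 : ∀ s ∈ I.carrier, cs.length (s * x) ≤ cs.length x)
    (h2 : ∀ s ∈ J.carrier, cs.length (x * s) ≤ cs.length x) : p.maxElt = x := by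
  obtain ⟨a, ha, b, hb, h⟩ := mk_eq_mk.1 (hx.trans p.mk_maxElt.symm)
  have e1 : cs.star (cs.star I.longest x) J.longest = x := by
    rw [I.star_eq_right I.longest_mem h1, J.star_eq_left J.longest_mem h2]
  have e2 : cs.star (cs.star I.longest p.maxElt) J.longest = p.maxElt := by
    rw [longest_star_maxElt, maxElt_star_longest]
  rw [← e2, h, mul_assoc, I.longest_star_mul ha, star_assoc, J.star_longest_mul hb,
    ← star_assoc, e1]

theorem maxElt_star (p : Coset I J) (q : Coset J K) :
    (p.star q).maxElt = cs.star p.maxElt q.maxElt := by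
  apply eq_maxElt _ rfl
  · intro s hs
    have h : cs.star s p.maxElt = p.maxElt :=
      I.star_eq_right (I.mem_parabolic hs) fun _ ht => p.maxElt_left ht
    obtain ⟨i, rfl⟩ := I.subset_simple hs
    have h' : cs.star (cs.simple i) (cs.star p.maxElt q.maxElt) = cs.star p.maxElt q.maxElt := by
      rw [← star_assoc, h]
    rw [simple_star, leftStar] at h'
    split_ifs at h' with h0
    · rw [h']
    · omega
  · intro s hs
    have h : cs.star q.maxElt s = q.maxElt :=
      K.star_eq_left (K.mem_parabolic hs) fun _ ht => q.maxElt_right ht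
    obtain ⟨i, rfl⟩ := K.subset_simple hs
    have h' : cs.star (cs.star p.maxElt q.maxElt) (cs.simple i) = cs.star p.maxElt q.maxElt := by
      rw [star_assoc, h]
    rw [star_simple, rightStar] at h'
    split_ifs at h' with h0
    · rw [h']
    · omega

theorem maxElt_one (I : cs.FinitarySubset) : (one I).maxElt = I.longest := by
  apply eq_maxElt
  · exact mk_eq_mk.2 ⟨1, one_mem _, I.longest⁻¹, inv_mem I.longest_mem, by simp⟩
  · exact fun s hs => I.length_le_longest (mul_mem (I.mem_parabolic hs) I.longest_mem)
  · exact fun s hs => I.length_le_longest (mul_mem I.longest_mem (I.mem_parabolic hs))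

theorem star_assoc' (p : Coset I J) (q : Coset J K) (r : Coset K L) :
    (p.star q).star r = p.star (q.star r) := by
  rw [star, maxElt_star, star_assoc, ← maxElt_star q r]
  rfl

theorem one_star' (p : Coset I J) : (one I).star p = p := by
  rw [star, maxElt_one, longest_star_maxElt, mk_maxElt]

theorem star_one' (p : Coset I J) : p.star (one J) = p := by
  rw [star, maxElt_one, maxElt_star_longest, mk_maxElt]

theorem length_maxElt_mul (p : Coset I J) :
    cs.length (p.maxElt * J.longest⁻¹) + cs.length J.longest = cs.length p.maxElt :=
  J.length_mul_longest J.longest_mem (fun _ h => J.length_le_longest h)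
    fun _ hs => p.maxElt_right hs

theorem length_mul_maxElt (p : Coset I J) :
    cs.length (I.longest⁻¹ * p.maxElt) + cs.length I.longest = cs.length p.maxElt :=
  I.length_longest_mul fun _ hs => p.maxElt_left hs

theorem star_maxElt_left (p : Coset I J) (q : Coset J K) :
    cs.star (p.maxElt * J.longest⁻¹) q.maxElt = cs.star p.maxElt q.maxElt := by
  have h : cs.star (p.maxElt * J.longest⁻¹) J.longest = p.maxElt := by
    rw [star_eq_mul] <;> rw [inv_mul_cancel_right]
    exact p.length_maxElt_mul.symm
  conv_rhs => rw [← h, star_assoc, q.longest_star_maxElt]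

theorem star_maxElt_right (p : Coset I J) (q : Coset J K) :
    cs.star p.maxElt (J.longest⁻¹ * q.maxElt) = cs.star p.maxElt q.maxElt := by
  have h : cs.star J.longest (J.longest⁻¹ * q.maxElt) = q.maxElt := by
    rw [star_eq_mul] <;> rw [mul_inv_cancel_left]
    rw [add_comm]; exact q.length_mul_maxElt.symm
  conv_rhs => rw [← h, ← star_assoc, p.maxElt_star_longest]

theorem length_star_add_le (p : Coset I J) (q : Coset J K) :
    cs.length (cs.star p.maxElt q.maxElt) + cs.length J.longest ≤
      cs.length p.maxElt + cs.length q.maxElt := by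
  have h1 := cs.length_star_le (p.maxElt * J.longest⁻¹) q.maxElt
  have h2 := p.length_maxElt_mul
  rw [star_maxElt_left] at h1
  omega

theorem isReducedComp_iff (p : Coset I J) (q : Coset J K) :
    p.IsReducedComp q ↔ cs.length (cs.star p.maxElt q.maxElt) + cs.length J.longest =
      cs.length p.maxElt + cs.length q.maxElt := by
  have h2 := p.length_maxElt_mul
  have h3 := q.length_mul_maxElt
  constructor
  · rintro ⟨⟨_, h⟩, _⟩
    omega
  · intro h
    refine ⟨⟨?_, by omega⟩, ⟨?_, by omega⟩⟩
    · rw [← star_maxElt_left, eq_comm]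
      apply star_eq_mul_of_length_star
      rw [star_maxElt_left]; omega
    · rw [← star_maxElt_right, eq_comm]
      apply star_eq_mul_of_length_star
      rw [star_maxElt_right]; omega

theorem isReducedComp_one_left (p : Coset I J) : (one I).IsReducedComp p := by
  rw [isReducedComp_iff, maxElt_one, longest_star_maxElt, add_comm]

theorem isReducedComp_one_right (p : Coset I J) : p.IsReducedComp (one J) := by
  rw [isReducedComp_iff, maxElt_one, maxElt_star_longest]

theorem isReducedComp_assoc (p : Coset I J) (q : Coset J K) (r : Coset K L) :
    p.IsReducedComp q ∧ (p.star q).IsReducedComp r ↔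
      q.IsReducedComp r ∧ p.IsReducedComp (q.star r) := by
  simp only [isReducedComp_iff, maxElt_star, star_assoc]
  have h1 := length_star_add_le p q
  have h2 := length_star_add_le q r
  have h3 := length_star_add_le p (q.star r)
  have h4 := length_star_add_le (p.star q) r
  rw [maxElt_star] at h3 h4
  rw [star_assoc] at h4
  omega

end Coset

/-! ### The nilCoxeter algebroid -/

variable (cs) in
/-- The nilCoxeter algebroid `D(W, S)`. Its objects are the finitary subsets of `S`. -/
def NilCoxeterAlgebroid : Type _ := cs.FinitarySubset

namespace NilCoxeterAlgebroid

open Classical in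
/-- Composition of morphisms, on basis elements: `∂_p ∘ ∂_q` is `∂_{p * q}` if `p * q` is reduced
and `0` otherwise. -/
noncomputable def compBasis {I J K : cs.FinitarySubset} (p : Coset I J) (q : Coset J K) :
    Coset I K →₀ ℤ :=
  if p.IsReducedComp q then Finsupp.single (p.star q) 1 else 0

/-- Composition of morphisms `g ∘ f`, as a bilinear map on free `ℤ`-modules. -/
noncomputable def compLin (I J K : cs.FinitarySubset) :
    (Coset I J →₀ ℤ) →ₗ[ℤ] (Coset J K →₀ ℤ) →ₗ[ℤ] (Coset I K →₀ ℤ) :=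
  Finsupp.linearCombination ℤ fun p => Finsupp.linearCombination ℤ fun q => compBasis p q

theorem compLin_single {I J K : cs.FinitarySubset} (p : Coset I J) (q : Coset J K) :
    compLin I J K (Finsupp.single p 1) (Finsupp.single q 1) = compBasis p q := by
  simp [compLin]

theorem compLin_assoc {I J K L : cs.FinitarySubset} (f : Coset I J →₀ ℤ) (g : Coset J K →₀ ℤ)
    (h : Coset K L →₀ ℤ) :
    compLin I K L (compLin I J K f g) h = compLin I J L f (compLin J K L g h) := by
  induction f using Finsupp.induction_linear with
  | zero => simp
  | add f f' h1 h2 => simp only [map_add, LinearMap.add_apply, h1, h2]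
  | single p a =>
  induction g using Finsupp.induction_linear with
  | zero => simp
  | add f f' h1 h2 => simp only [map_add, LinearMap.add_apply, h1, h2]
  | single q b =>
  induction h using Finsupp.induction_linear with
  | zero => simp
  | add f f' h1 h2 => simp only [map_add, h1, h2]
  | single r c =>
  rw [← mul_one a, ← mul_one b, ← mul_one c, ← smul_eq_mul, ← smul_eq_mul, ← smul_eq_mul,
    ← Finsupp.smul_single, ← Finsupp.smul_single, ← Finsupp.smul_single]
  simp only [map_smul, LinearMap.smul_apply, compLin_single]
  congr 3
  classical
  have e1 : compLin I K L (compBasis p q) (Finsupp.single r 1) =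
      if p.IsReducedComp q ∧ (p.star q).IsReducedComp r then
        Finsupp.single ((p.star q).star r) 1 else 0 := by
    by_cases h1 : p.IsReducedComp q
    · rw [compBasis, if_pos h1, compLin_single, compBasis]; simp [h1]
    · rw [compBasis, if_neg h1]; simp [h1]
  have e2 : compLin I J L (Finsupp.single p 1) (compBasis q r) =
      if q.IsReducedComp r ∧ p.IsReducedComp (q.star r) then
        Finsupp.single (p.star (q.star r)) 1 else 0 := by
    by_cases h1 : q.IsReducedComp r
    · rw [compBasis, if_pos h1, compLin_single, compBasis]; simp [h1]
    · rw [compBasis, if_neg h1]; simp [h1]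
  rw [e1, e2, Coset.star_assoc']
  exact if_congr (Coset.isReducedComp_assoc p q r) rfl rfl

theorem compLin_one_left {I J : cs.FinitarySubset} (f : Coset I J →₀ ℤ) :
    compLin I I J (Finsupp.single (Coset.one I) 1) f = f := by
  induction f using Finsupp.induction_linear with
  | zero => simp
  | add f f' h1 h2 => simp only [map_add, h1, h2]
  | single p a =>
    rw [← mul_one a, ← smul_eq_mul, ← Finsupp.smul_single, map_smul, compLin_single, compBasis,
      if_pos p.isReducedComp_one_left, p.one_star']

theorem compLin_one_right {I J : cs.FinitarySubset} (f : Coset I J →₀ ℤ) :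
    compLin I J J f (Finsupp.single (Coset.one J) 1) = f := by
  induction f using Finsupp.induction_linear with
  | zero => simp
  | add f f' h1 h2 => simp only [map_add, LinearMap.add_apply, h1, h2]
  | single p a =>
    rw [← mul_one a, ← smul_eq_mul, ← Finsupp.smul_single, map_smul, LinearMap.smul_apply,
      compLin_single, compBasis, if_pos p.isReducedComp_one_right, p.star_one']

/-- The morphisms from `J` to `I` form the free `ℤ`-module on the set of `(I, J)`-cosets. -/
noncomputable instance : Category (NilCoxeterAlgebroid cs) where
  Hom J I := Coset (cs := cs) I J →₀ ℤ
  id I := Finsupp.single (Coset.one I) 1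
  comp {K J I} f g := compLin I J K g f
  id_comp f := compLin_one_right f
  comp_id f := compLin_one_left f
  assoc f g h := (compLin_assoc h g f).symm

noncomputable instance : Preadditive (NilCoxeterAlgebroid cs) where
  homGroup J I := inferInstanceAs (AddCommGroup (Coset (cs := cs) I J →₀ ℤ))
  add_comp K J I f f' g := (compLin I J K g).map_add f f'
  comp_add K J I f g g' := LinearMap.congr_fun ((compLin I J K).map_add g g') f

/-- The basis element `∂_p : J ⟶ I` for an `(I, J)`-coset `p`. -/
noncomputable def partialHom {I J : NilCoxeterAlgebroid cs} (p : Coset (cs := cs) I J) : J ⟶ I :=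
  (Finsupp.single p 1 : Coset (cs := cs) I J →₀ ℤ)

open Classical in
/-- The composition rule: `∂_p ∘ ∂_q` is `∂_{p * q}` if `p * q` is reduced, and `0` otherwise. -/
theorem partialHom_comp {I J K : NilCoxeterAlgebroid cs} (p : Coset (cs := cs) I J)
    (q : Coset (cs := cs) J K) :
    partialHom q ≫ partialHom p = if p.IsReducedComp q then partialHom (p.star q) else 0 :=
  compLin_single p q

end NilCoxeterAlgebroid

end CoxeterSystem

/-- A wide `ℤ`-linear subcategory of a `ℤ`-linear category `C`: a subgroup of every group of
morphisms, containing the identities and closed under composition. -/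
structure LinearSubcategory (C : Type*) [Category C] [Preadditive C] where
  /-- the morphisms of the subcategory -/
  hom (X Y : C) : Submodule ℤ (X ⟶ Y)
  id_mem (X : C) : 𝟙 X ∈ hom X X
  comp_mem {X Y Z : C} {f : X ⟶ Y} {g : Y ⟶ Z} : f ∈ hom X Y → g ∈ hom Y Z → f ≫ g ∈ hom X Z

/-- The `ℤ`-linear subcategory (with all objects) generated by a class of morphisms: the
intersection of all those containing the class. -/
def LinearSubcategory.generatedBy {C : Type*} [Category C] [Preadditive C]
    (P : MorphismProperty C) : LinearSubcategory C where
  hom X Y := sInf {N | ∃ A : LinearSubcategory C,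
    (∀ ⦃X Y : C⦄ (f : X ⟶ Y), P f → f ∈ A.hom X Y) ∧ N = A.hom X Y}
  id_mem X := by
    rw [Submodule.mem_sInf]
    rintro _ ⟨A, _, rfl⟩
    exact A.id_mem X
  comp_mem {X Y Z f g} hf hg := by
    rw [Submodule.mem_sInf] at *
    rintro _ ⟨A, hA, rfl⟩
    exact A.comp_mem (hf _ ⟨A, hA, rfl⟩) (hg _ ⟨A, hA, rfl⟩)

namespace CoxeterSystem

variable {B W : Type*} [Group W] {M : CoxeterMatrix B}

/-- The class of the morphisms `∂_p`, for `p` an atomic coset. -/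
def atomicMorphisms (cs : CoxeterSystem M W) : MorphismProperty (NilCoxeterAlgebroid cs) :=
  fun J I f => ∃ p : Coset (cs := cs) I J, p.IsAtomic ∧ f = NilCoxeterAlgebroid.partialHom p

/-- The subcategory `AD(W, S)` of `D(W, S)` generated by the `∂_p` for atomic cosets `p`. -/
noncomputable def atomicSubcategory (cs : CoxeterSystem M W) : LinearSubcategory (NilCoxeterAlgebroid cs) :=
  LinearSubcategory.generatedBy cs.atomicMorphisms

end CoxeterSystem

open CategoryTheory

namespace CoxeterSystem

variable {B W : Type*} [Group W] {M : CoxeterMatrix B} {cs : CoxeterSystem M W}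

/-! ### Parabolic subgroups of arbitrary type -/

/-! A core `(I, J)`-coset is the same thing as an element `x` with `x J x⁻¹ = I` that is shortest in
`x W_J` (`IsCoreElt`). Its double coset is the one-sided coset `x W_J`, with minimal element `x` and
maximal element `x w_J`. In these terms a composition of core cosets with minimal elements `x` and
`y` is reduced only if `ℓ(x y w_K) = ℓ(x) + ℓ(y) + ℓ(w_K)`. Then `x y` is again a core element, so
the span of the `∂_p` with `p` core is closed under composition. It contains the atomic generators,
hence all of `AD`.

For the converse, every core element `x ≠ 1` loses an atomic factor on the right
(`IsCoreElt.exists_atomic_factorization`). Let `t` be a right descent of `x`, put `X = J ∪ {t}`, and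
write `x = y v` with `y` shortest in `x W_X` and `v ∈ W_X`. Lengths add in `y W_X`, which forces `L
= v J v⁻¹` to consist of simple reflections in `X`. All of `X` are left descents of `v w_J`
(`IsCoreElt.mul_longest_leftDescent`), and this bounds lengths in `W_X`. So `K = X` is finitary and
`v w_J = w_K`: the coset of `v` is atomic, with reduced expression `[L, K, J]`. Since `v ≠ 1`, `y`
is a shorter core element, and induction on length expresses `∂_p` through atomic morphisms.

Linear independence is inherited from the basis of `Hom(J, I)`. Finiteness of `W_X` is a conclusion
of the argument, so the preliminary lemmas treat parabolic subgroups on arbitrary sets of simple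
reflections. -/

theorem exists_reduced_word_of_mem_closure {X : Set W} (hX : X ⊆ Set.range cs.simple) {x : W}
    (hx : x ∈ Subgroup.closure X) :
    ∃ ω : List B, (∀ i ∈ ω, cs.simple i ∈ X) ∧ cs.IsReduced ω ∧ cs.wordProd ω = x := by
  suffices h : ∃ ω : List B, (∀ i ∈ ω, cs.simple i ∈ X) ∧ cs.wordProd ω = x by
    obtain ⟨ω, h1, h2⟩ := h
    obtain ⟨ω', h3, h4, h5⟩ := cs.exists_reduced_subset ω
    exact ⟨ω', fun i hi => h1 i (h3 hi), h4, h5.trans h2⟩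
  induction hx using Subgroup.closure_induction with
  | mem s hs =>
    obtain ⟨i, rfl⟩ := hX hs
    exact ⟨[i], by simpa using hs, by simp⟩
  | one => exact ⟨[], by simp⟩
  | mul x y _ _ hx hy =>
    obtain ⟨ω, h1, rfl⟩ := hx
    obtain ⟨ω', h2, rfl⟩ := hy
    refine ⟨ω ++ ω', fun i hi => ?_, by simp [wordProd_append]⟩
    rcases List.mem_append.1 hi with hi | hi
    exacts [h1 i hi, h2 i hi]
  | inv x _ hx =>
    obtain ⟨ω, h1, rfl⟩ := hx
    exact ⟨ω.reverse, by simpa using h1, by simp⟩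

/-- Lengths add in `y W_X` if `y` is a shortest element of this coset. -/
theorem length_mul_of_minimal {X : Set W} (hX : X ⊆ Set.range cs.simple) {y : W}
    (hmin : ∀ a ∈ Subgroup.closure X, cs.length y ≤ cs.length (y * a)) {a : W}
    (ha : a ∈ Subgroup.closure X) : cs.length (y * a) = cs.length y + cs.length a := by
  obtain ⟨ω, h1, h2, rfl⟩ := exists_reduced_word_of_mem_closure hX ha
  clear ha
  induction ω using List.reverseRecOn with
  | nil => simp
  | append_singleton ω i ih =>
    have h2' : cs.IsReduced ω := by simpa using h2.take ω.length
    have h1' : ∀ j ∈ ω, cs.simple j ∈ X := fun j hj => h1 j (List.mem_append_left _ hj)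
    have ih := ih h1' h2'
    have hωm : cs.wordProd ω ∈ Subgroup.closure X := by
      refine list_prod_mem fun z hz => ?_
      obtain ⟨j, hj, rfl⟩ := List.mem_map.1 hz
      exact Subgroup.subset_closure (h1' j hj)
    have hlen := h2.eq
    rw [wordProd_append, wordProd_singleton, List.length_append, List.length_singleton] at hlen
    rw [wordProd_append, wordProd_singleton, ← mul_assoc, hlen]
    have h2e := h2'.eq
    rcases cs.length_mul_simple (y * cs.wordProd ω) i with h | h
    · omega
    · exfalso
      obtain ⟨τ, hτ, hτy⟩ := cs.exists_isReduced y
      have hτe := hτ.eq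
      -- With `w` the product of `ω` and `s` the reflection of `i`, exchange deletes one letter of
      -- `τ ++ ω`. If it lies in `τ`, then `y (w s w⁻¹)` is shorter than `y`, against minimality; if
      -- it lies in `ω`, then `w s` is shorter than its reduced word `ω ++ [i]`.
      obtain ⟨k, hk, he⟩ := cs.exchange_right (τ ++ ω) i (by
        rw [wordProd_append, ← hτy]; omega)
      rw [wordProd_append, ← hτy] at he
      rcases lt_or_ge k τ.length with hk' | hk'
      · rw [List.eraseIdx_append_of_lt_length hk', wordProd_append] at he
        have h5 := hmin (cs.wordProd ω * cs.simple i * (cs.wordProd ω)⁻¹)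
          (mul_mem (mul_mem hωm (Subgroup.subset_closure (h1 i (by simp)))) (inv_mem hωm))
        rw [← mul_assoc, ← mul_assoc, he, mul_inv_cancel_right] at h5
        have h6 := cs.length_wordProd_le (τ.eraseIdx k)
        rw [List.length_eraseIdx_of_lt hk'] at h6
        rw [hτy] at h5
        omega
      · rw [List.eraseIdx_append_of_length_le hk', wordProd_append, ← hτy, mul_assoc,
          mul_right_inj] at he
        have h6 := cs.length_wordProd_le (ω.eraseIdx (k - τ.length))
        rw [List.length_append] at hk
        rw [← he, List.length_eraseIdx_of_lt (by omega)] at h6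
        omega

/-- Multiplying by a simple reflection in the Coxeter monoid either lengthens an element or fixes
it. -/
theorem length_le_length_star (x y : W) : cs.length x ≤ cs.length (cs.star x y) := by
  obtain ⟨ω, h, rfl⟩ := cs.exists_isReduced y
  rw [star_eq_foldl cs x h]
  clear h
  induction ω generalizing x with
  | nil => rfl
  | cons i ω ih =>
    refine le_trans ?_ (ih _)
    dsimp only [rightStar]
    split_ifs <;> omega

theorem exists_minimal_mul (X : Set W) (x : W) :
    ∃ a ∈ Subgroup.closure X, ∀ b ∈ Subgroup.closure X,
      cs.length (x * a) ≤ cs.length (x * a * b) := by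
  obtain ⟨a, ha, h⟩ := exists_minimalFor_of_wellFoundedLT (· ∈ Subgroup.closure X)
    (fun a => cs.length (x * a)) ⟨1, one_mem _⟩
  refine ⟨a, ha, fun b hb => ?_⟩
  rw [mul_assoc]
  exact (le_total _ _).elim id (h (mul_mem ha hb))

/-- An element with all of `X` among its left descents is at least as long as every element of
`W_X`. -/
theorem length_le_of_leftDescents {X : Set W} (hX : X ⊆ Set.range cs.simple) {u : W}
    (hu : ∀ s ∈ X, cs.length (s * u) ≤ cs.length u) {a : W} (ha : a ∈ Subgroup.closure X) :
    cs.length a ≤ cs.length u := by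
  obtain ⟨ω, h1, h2, rfl⟩ := exists_reduced_word_of_mem_closure hX ha
  -- Every letter of `ω` fixes `u` in the Coxeter monoid; a star product is never shorter than its
  -- left factor.
  have h : cs.star (cs.wordProd ω) u = u := by
    rw [star_eq_foldr cs h2]
    clear h2 ha
    induction ω with
    | nil => rfl
    | cons i ω ih =>
      rw [List.foldr_cons, ih (fun j hj => h1 j (List.mem_cons_of_mem _ hj)), leftStar, if_neg]
      exact not_lt.2 (hu _ (h1 i (by simp)))
  conv_rhs => rw [← h]
  exact length_le_length_star _ _

/-- A parabolic subgroup of finite rank with bounded length function is finite. -/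
theorem finite_closure_of_length_le {X : Set W} (hX : X ⊆ Set.range cs.simple) (hf : X.Finite)
    (n : ℕ) (h : ∀ a ∈ Subgroup.closure X, cs.length a ≤ n) : Finite (Subgroup.closure X) := by
  have : Finite X := hf
  -- The products of at most `n` letters from the finite set `X`.
  have hfin : (⋃ m ∈ Finset.range (n + 1),
      Set.range fun f : Fin m → X => (List.ofFn fun k => (f k : W)).prod).Finite :=
    Set.Finite.biUnion (Finset.finite_toSet _) fun m _ => Set.finite_range _
  refine (hfin.subset fun a ha => ?_ : (Subgroup.closure X : Set W).Finite)
  obtain ⟨ω, h1, h2, rfl⟩ := exists_reduced_word_of_mem_closure hX ha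
  have h3 := h _ ha
  rw [h2.eq] at h3
  simp only [Set.mem_iUnion]
  refine ⟨ω.length, by simpa [Nat.lt_succ_iff] using h3,
    fun k => ⟨cs.simple ω[k], h1 _ (List.getElem_mem _)⟩, ?_⟩
  rw [wordProd]
  exact congrArg List.prod (List.ext_getElem (by simp) (by simp))

namespace FinitarySubset

theorem carrier_finite (I : cs.FinitarySubset) : I.carrier.Finite :=
  (show (I.parabolic : Set W).Finite from I.finite_parabolic).subset Subgroup.subset_closure

theorem length_mul_of_minimal (J : cs.FinitarySubset) {x : W}
    (hx : ∀ a ∈ J.parabolic, cs.length x ≤ cs.length (x * a)) {a : W} (ha : a ∈ J.parabolic) :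
    cs.length (x * a) = cs.length x + cs.length a :=
  CoxeterSystem.length_mul_of_minimal J.subset_simple hx ha

/-- Both sides equal the star product `w_I * u`: the descents of `u` absorb `w_I`, and `w_I` absorbs
every element of `W_I`. -/
theorem eq_longest (I : cs.FinitarySubset) {u : W} (hu : u ∈ I.parabolic)
    (h : ∀ s ∈ I.carrier, cs.length (s * u) ≤ cs.length u) : u = I.longest := by
  rw [← I.star_eq_right I.longest_mem h]
  exact I.star_eq_left hu fun s hs =>
    I.length_le_longest (mul_mem I.longest_mem (I.mem_parabolic hs))

end FinitarySubset

/-! ### Core cosets -/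

/-- The elements `x` which conjugate `J` to `I` and are shortest in `x W_J`. These are the minimal
elements of the core `(I, J)`-cosets. -/
structure IsCoreElt (I J : cs.FinitarySubset) (x : W) : Prop where
  image_eq : (fun t => x * t * x⁻¹) '' J.carrier = I.carrier
  length_le : ∀ a ∈ J.parabolic, cs.length x ≤ cs.length (x * a)

namespace IsCoreElt

variable {I J K : cs.FinitarySubset} {x y : W}

theorem length_mul (hx : IsCoreElt I J x) {a : W} (ha : a ∈ J.parabolic) :
    cs.length (x * a) = cs.length x + cs.length a :=
  J.length_mul_of_minimal hx.length_le ha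

theorem conj_mem (hx : IsCoreElt I J x) {s : W} (hs : s ∈ I.carrier) :
    x⁻¹ * s * x ∈ J.carrier := by
  rw [← hx.image_eq] at hs
  obtain ⟨t, ht, rfl⟩ := hs
  simpa [mul_assoc] using ht

theorem parabolic_map (hx : IsCoreElt I J x) :
    J.parabolic.map (MulAut.conj x).toMonoidHom = I.parabolic := by
  rw [FinitarySubset.parabolic, FinitarySubset.parabolic, MonoidHom.map_closure, ← hx.image_eq]
  rfl

theorem conj_mem_parabolic (hx : IsCoreElt I J x) {a : W} (ha : a ∈ I.parabolic) :
    x⁻¹ * a * x ∈ J.parabolic := by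
  rw [← hx.parabolic_map] at ha
  obtain ⟨b, hb, rfl⟩ := ha
  simpa [mul_assoc] using hb

/-- The double coset of `x` is the coset `x W_J`. -/
theorem mk_eq_iff (hx : IsCoreElt I J x) {z : W} :
    DoubleCoset.mk I.parabolic J.parabolic z = DoubleCoset.mk I.parabolic J.parabolic x ↔
      ∃ b ∈ J.parabolic, z = x * b := by
  rw [eq_comm, Coset.mk_eq_mk]
  constructor
  · rintro ⟨a, ha, b, hb, rfl⟩
    exact ⟨x⁻¹ * a * x * b, mul_mem (hx.conj_mem_parabolic ha) hb, by group⟩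
  · rintro ⟨b, hb, rfl⟩
    exact ⟨1, one_mem _, b, hb, by simp⟩

/-- One-sided minimality is enough, because the double coset is `x W_J` and its elements `x b` have
length `ℓ(x) + ℓ(b)`. -/
theorem minElt_mk (hx : IsCoreElt I J x) :
    Coset.minElt (DoubleCoset.mk I.parabolic J.parabolic x : Coset I J) = x := by
  set p : Coset I J := DoubleCoset.mk I.parabolic J.parabolic x with hp
  obtain ⟨h1, h2⟩ := p.exists_minElt.choose_spec
  change p.minElt ∈ p.elements at h1
  obtain ⟨b, hb, h⟩ := hx.mk_eq_iff.1 h1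
  have h3 : cs.length p.minElt ≤ cs.length x := h2 x hp.symm
  rw [h, hx.length_mul hb] at h3
  rw [h, cs.length_eq_zero_iff.1 (show cs.length b = 0 by omega), mul_one]

/-- For `s ∈ I` one has `s x w_J = x (x⁻¹ s x) w_J`, so left multiplication by `I` also reduces to
maximality of `w_J` in `W_J`. -/
theorem maxElt_mk (hx : IsCoreElt I J x) :
    Coset.maxElt (DoubleCoset.mk I.parabolic J.parabolic x : Coset I J) = x * J.longest := by
  refine Coset.eq_maxElt _ (hx.mk_eq_iff.2 ⟨_, J.longest_mem, rfl⟩) (fun s hs => ?_)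
    fun s hs => ?_
  · have h : s * (x * J.longest) = x * (x⁻¹ * s * x * J.longest) := by group
    have hm := mul_mem (J.mem_parabolic (hx.conj_mem hs)) J.longest_mem
    rw [h, hx.length_mul hm, hx.length_mul J.longest_mem]
    have := J.length_le_longest hm
    omega
  · have hm := mul_mem J.longest_mem (J.mem_parabolic hs)
    rw [mul_assoc, hx.length_mul hm, hx.length_mul J.longest_mem]
    have := J.length_le_longest hm
    omega

theorem isCore_mk (hx : IsCoreElt I J x) :
    Coset.IsCore (DoubleCoset.mk I.parabolic J.parabolic x : Coset I J) := by
  rw [Coset.IsCore, Coset.leftRed, Coset.rightRed, hx.minElt_mk]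
  refine ⟨by rw [hx.image_eq, Set.inter_self], Set.inter_eq_right.2 fun t ht => ?_⟩
  refine ⟨x * t * x⁻¹, ?_, by group⟩
  rw [← hx.image_eq]
  exact ⟨t, ht, rfl⟩

theorem one (I : cs.FinitarySubset) : IsCoreElt I I 1 := ⟨by simp, by simp⟩

theorem eq_of_one (h : IsCoreElt I J 1) : I = J := by
  ext1
  rw [← h.image_eq]
  simp

theorem length_mul_longest (hx : IsCoreElt I J x) :
    cs.length (x * J.longest) = cs.length x + cs.length J.longest :=
  hx.length_mul J.longest_mem

/-- The composition of core elements is core as soon as lengths add. -/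
theorem mul (hx : IsCoreElt I J x) (hy : IsCoreElt J K y)
    (h : cs.length x + cs.length y + cs.length K.longest ≤ cs.length (x * y * K.longest)) :
    IsCoreElt I K (x * y) := by
  refine ⟨?_, fun a ha => ?_⟩
  · rw [← hx.image_eq, ← hy.image_eq, Set.image_image]
    simp [mul_assoc]
  · obtain ⟨b, hb, hmin⟩ := exists_minimal_mul (cs := cs) K.carrier (x * y)
    have hm := mul_mem (inv_mem hb) K.longest_mem
    have h1 := K.length_mul_of_minimal hmin hm
    rw [show x * y * b * (b⁻¹ * K.longest) = x * y * K.longest by group] at h1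
    have h2 := K.length_le_longest hm
    have h3 := cs.length_mul_le x y
    have h4 := hmin (b⁻¹ * a) (mul_mem (inv_mem hb) ha)
    rw [show x * y * b * (b⁻¹ * a) = x * y * a by group] at h4
    omega

end IsCoreElt

/-! ### Core cosets versus core elements, and closure under reduced composition -/

namespace Coset

variable {I J K : cs.FinitarySubset}

theorem mk_minElt (p : Coset I J) : DoubleCoset.mk _ _ p.minElt = p :=
  p.exists_minElt.choose_spec.1

/-- The left redundancy gives `I ⊆ x J x⁻¹` and the right one gives `J ⊆ x⁻¹ I x`. Together with
`isCore_mk` this is the dictionary between core cosets and core elements. -/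
theorem IsCore.isCoreElt {p : Coset I J} (hp : p.IsCore) : IsCoreElt I J p.minElt := by
  obtain ⟨h1, h2⟩ := hp
  refine ⟨Set.Subset.antisymm ?_ (Set.inter_eq_left.1 h1), fun a ha => ?_⟩
  · rintro _ ⟨t, ht, rfl⟩
    obtain ⟨s, hs, rfl⟩ := (Set.inter_eq_right.1 h2) ht
    simpa [mul_assoc] using hs
  · refine p.exists_minElt.choose_spec.2 _ ?_
    change DoubleCoset.mk _ _ (p.minElt * a) = p
    conv_rhs => rw [← p.mk_minElt]
    exact (mk_eq_mk.2 ⟨1, one_mem _, a, ha, by simp⟩).symm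

theorem isCore_one (I : cs.FinitarySubset) : (one I).IsCore := (IsCoreElt.one I).isCore_mk

/-- A reduced composition of core cosets is core. -/
theorem IsCore.star {p : Coset I J} {q : Coset J K} (hp : p.IsCore) (hq : q.IsCore)
    (h : p.IsReducedComp q) : (p.star q).IsCore := by
  have hx := hp.isCoreElt
  have hy := hq.isCoreElt
  have ep := hx.maxElt_mk
  have eq := hy.maxElt_mk
  rw [mk_minElt] at ep eq
  obtain ⟨⟨h1, h2⟩, -⟩ := h
  -- With `p̄ = x w_J` and `q̄ = y w_K`, reducedness says that `p̄ * q̄ = x y w_K` has length `ℓ(x)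
  -- + ℓ(y) + ℓ(w_K)`.
  rw [← h1, ep, mul_inv_cancel_right, eq, ← mul_assoc, hy.length_mul_longest, ← add_assoc] at h2
  rw [ep, mul_inv_cancel_right, ← ep, eq, ← mul_assoc, ← eq] at h1
  have hxy := hx.mul hy h2.ge
  have : p.star q = DoubleCoset.mk I.parabolic K.parabolic (p.minElt * q.minElt) :=
    hxy.mk_eq_iff.2 ⟨_, K.longest_mem, h1.symm⟩
  rw [this]
  exact hxy.isCore_mk

end Coset

/-! ### Splitting off an atomic factor -/

namespace IsCoreElt

variable {I J K : cs.FinitarySubset} {x y : W}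

/-- If `v ≠ 1` is a core element of `W_K`, where `K = J ∪ {t}`, then all of `K` are left descents
of `v w_J`. -/
theorem mul_longest_leftDescent {t v : W} (hJ : IsCoreElt I J v)
    (hsub : I.carrier ⊆ insert t J.carrier) (ht : t ∈ Set.range cs.simple) (htJ : t ∉ J.carrier)
    (hv : v ∈ Subgroup.closure (insert t J.carrier)) (hv1 : v ≠ 1) :
    ∃ s ∉ I.carrier, insert t J.carrier = insert s I.carrier ∧
      ∀ r ∈ insert t J.carrier, cs.length (r * (v * J.longest)) ≤ cs.length (v * J.longest) := by
  have hX : insert t J.carrier ⊆ Set.range cs.simple := Set.insert_subset ht J.subset_simple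
  have hleft : ∀ s ∈ I.carrier, cs.length (s * (v * J.longest)) ≤ cs.length (v * J.longest) := by
    intro s hs
    have h : s * (v * J.longest) = v * (v⁻¹ * s * v * J.longest) := by group
    have hm := mul_mem (J.mem_parabolic (hJ.conj_mem hs)) J.longest_mem
    rw [h, hJ.length_mul hm, hJ.length_mul J.longest_mem]
    have := J.length_le_longest hm
    omega
  obtain ⟨ω, h1, h2, rfl⟩ := exists_reduced_word_of_mem_closure hX hv
  obtain _ | ⟨i, ω⟩ := ω
  · simp at hv1
  set v := cs.wordProd (i :: ω) with hvdef
  have hi : cs.simple i ∈ insert t J.carrier := h1 i (by simp)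
  have hdesc : cs.length (cs.simple i * v) < cs.length v := by
    have h3 := cs.length_wordProd_le ω
    rw [h2.eq, hvdef, wordProd_cons, simple_mul_simple_cancel_left, List.length_cons]
    omega
  -- An element `s` of `I` cannot shorten `v`, since `s v = v (v⁻¹ s v)` lies in `v W_J`, where `v`
  -- is shortest.
  have hiI : cs.simple i ∉ I.carrier := fun hs => by
    have hm := hJ.conj_mem hs
    have h4 := hJ.length_le _ (J.mem_parabolic hm)
    rw [show v * (v⁻¹ * cs.simple i * v) = cs.simple i * v by group] at h4
    omega
  -- Conjugation by `v` is a bijection from `J` to `I`, so adding the one missing reflection to `I`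
  -- already fills `J ∪ {t}`.
  have hcard : I.carrier.ncard = J.carrier.ncard := by
    rw [← hJ.image_eq]
    exact Set.ncard_image_of_injective _ (MulAut.conj v).injective
  have heq : insert (cs.simple i) I.carrier = insert t J.carrier := by
    refine Set.eq_of_subset_of_ncard_le (Set.insert_subset hi hsub) ?_ (J.carrier_finite.insert t)
    rw [Set.ncard_insert_of_notMem htJ J.carrier_finite,
      Set.ncard_insert_of_notMem hiI I.carrier_finite, hcard]
  refine ⟨cs.simple i, hiI, heq.symm, ?_⟩
  rw [← heq]
  rintro r (rfl | hr)
  · have h5 := cs.length_mul_le (cs.simple i * v) J.longest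
    rw [mul_assoc] at h5
    rw [hJ.length_mul_longest]
    omega
  · exact hleft r hr

/-- A nontrivial core coset is a reduced composition of a core coset with shorter minimal element
and an atomic coset. -/
theorem exists_atomic_factorization (hx : IsCoreElt I J x) (hx1 : x ≠ 1) :
    ∃ (L : cs.FinitarySubset) (y : W), IsCoreElt I L y ∧ cs.length y < cs.length x ∧
      ∃ r : Coset L J, r.IsAtomic ∧
        Coset.IsReducedComp (DoubleCoset.mk I.parabolic L.parabolic y : Coset I L) r ∧
        Coset.star (DoubleCoset.mk I.parabolic L.parabolic y : Coset I L) r =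
          DoubleCoset.mk I.parabolic J.parabolic x := by
  obtain ⟨i, hi⟩ := cs.exists_rightDescent_of_ne_one hx1
  set t := cs.simple i with ht
  have htJ : t ∉ J.carrier := fun h => by
    have := hx.length_le t (J.mem_parabolic h)
    exact absurd hi (not_lt.2 this)
  have hX : insert t J.carrier ⊆ Set.range cs.simple :=
    Set.insert_subset ⟨i, rfl⟩ J.subset_simple
  have hJX : J.parabolic ≤ Subgroup.closure (insert t J.carrier) :=
    Subgroup.closure_mono (Set.subset_insert _ _)
  have htX : t ∈ Subgroup.closure (insert t J.carrier) :=
    Subgroup.subset_closure (Set.mem_insert _ _)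
  -- Parabolic decomposition `x = y v` with respect to `X = J ∪ {t}`; the descent `t` of `x` ensures
  -- `v ≠ 1`.
  obtain ⟨a, ha, hmin⟩ := exists_minimal_mul (cs := cs) (insert t J.carrier) x
  obtain ⟨y, hy⟩ : ∃ y, y = x * a := ⟨_, rfl⟩
  obtain ⟨v, hv⟩ : ∃ v, v = a⁻¹ := ⟨_, rfl⟩
  have hvX : v ∈ Subgroup.closure (insert t J.carrier) := hv ▸ inv_mem ha
  have hxyv : x = y * v := by rw [hy, hv, mul_inv_cancel_right]
  rw [← hy] at hmin
  have hadd : ∀ b ∈ Subgroup.closure (insert t J.carrier),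
      cs.length (y * b) = cs.length y + cs.length b :=
    fun b hb => CoxeterSystem.length_mul_of_minimal hX hmin hb
  have hlx : cs.length x = cs.length y + cs.length v := by rw [hxyv, hadd v hvX]
  have hv1 : v ≠ 1 := by
    rintro h
    rw [h, mul_one] at hxyv
    exact absurd hi (not_lt.2 (hxyv ▸ hmin t htX))
  have hvJ : ∀ b ∈ J.parabolic, cs.length v ≤ cs.length (v * b) := fun b hb => by
    have h1 := hx.length_le b hb
    rw [hlx, hxyv, mul_assoc, hadd _ (mul_mem hvX (hJX hb))] at h1
    omega
  -- Since `x s x⁻¹ ∈ I` is a simple reflection and `y (v s v⁻¹) = (x s x⁻¹) y`, this product has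
  -- length at most `ℓ(y) + 1`. Lengths add in `y W_X`, so `v s v⁻¹` has length at most one, and
  -- being nontrivial it is a letter of `X`.
  have hconj : ∀ s ∈ J.carrier, v * s * v⁻¹ ∈ insert t J.carrier := fun s hs => by
    have hm : v * s * v⁻¹ ∈ Subgroup.closure (insert t J.carrier) :=
      mul_mem (mul_mem hvX (hJX (J.mem_parabolic hs))) (inv_mem hvX)
    have h1 : x * s * x⁻¹ ∈ I.carrier := by rw [← hx.image_eq]; exact ⟨s, hs, rfl⟩
    obtain ⟨j, hj⟩ := I.subset_simple h1
    have h2 : y * (v * s * v⁻¹) = cs.simple j * y := by rw [hj, hxyv]; group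
    have h3 := hadd _ hm
    have h4 := cs.length_mul_le (cs.simple j) y
    rw [h2] at h3
    rw [length_simple] at h4
    obtain ⟨ω, h5, h6, h7⟩ := exists_reduced_word_of_mem_closure hX hm
    have h8 := h6.eq
    rw [h7] at h8
    have hs1 : s ≠ 1 := by
      obtain ⟨k, rfl⟩ := J.subset_simple hs
      intro h
      have := cs.length_simple k
      rw [h, length_one] at this
      omega
    match ω, h8 with
    | [], _ =>
      rw [wordProd_nil, eq_comm, conj_eq_one_iff] at h7
      exact absurd h7 hs1
    | [k], _ =>
      rw [← h7, wordProd_singleton]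
      exact h5 k (by simp)
    | _ :: _ :: _, h8 =>
      simp only [List.length_cons] at h8
      omega
  have hLX : (fun s => v * s * v⁻¹) '' J.carrier ⊆ insert t J.carrier := by
    rintro _ ⟨s, hs, rfl⟩
    exact hconj s hs
  let L : cs.FinitarySubset :=
    { carrier := (fun s => v * s * v⁻¹) '' J.carrier
      subset_simple := hLX.trans hX
      finite_parabolic := by
        have h1 : Subgroup.closure ((fun s => v * s * v⁻¹) '' J.carrier) =
            J.parabolic.map (MulAut.conj v).toMonoidHom := by
          rw [FinitarySubset.parabolic, MonoidHom.map_closure]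
          rfl
        rw [h1]
        exact (show (J.parabolic : Set W).Finite from J.finite_parabolic).image _ }
  have hvL : IsCoreElt L J v := ⟨rfl, hvJ⟩
  obtain ⟨s, hsL, hK, hdesc⟩ := hvL.mul_longest_leftDescent hLX ⟨i, rfl⟩ htJ hvX hv1
  -- `K` is finitary because `v w_J`, having all of `X` as left descents, is at least as long as
  -- every element of `W_X`.
  let K : cs.FinitarySubset :=
    { carrier := insert t J.carrier
      subset_simple := hX
      finite_parabolic := finite_closure_of_length_le hX (J.carrier_finite.insert t) _
        fun b hb => length_le_of_leftDescents hX hdesc hb }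
  have hvK : v * J.longest = K.longest :=
    K.eq_longest (mul_mem hvX (hJX J.longest_mem)) hdesc
  have hLK : L.parabolic ≤ K.parabolic := Subgroup.closure_mono hLX
  -- `y L y⁻¹ = y v J v⁻¹ y⁻¹ = x J x⁻¹ = I`, and `y` is shortest even in `y W_K`.
  have hyL : IsCoreElt I L y := by
    refine ⟨?_, fun b hb => hmin b (hLK hb)⟩
    change _ '' (_ '' _) = _
    rw [← hx.image_eq, Set.image_image, hxyv]
    simp [mul_assoc]
  have hmax : Coset.maxElt (DoubleCoset.mk L.parabolic J.parabolic v : Coset L J) = K.longest :=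
    hvL.maxElt_mk.trans hvK
  have hstar : cs.star (y * L.longest) K.longest = y * K.longest := by
    have h := Coset.star_maxElt_left (DoubleCoset.mk I.parabolic L.parabolic y : Coset I L)
      (DoubleCoset.mk L.parabolic J.parabolic v : Coset L J)
    rw [hyL.maxElt_mk, hmax, mul_inv_cancel_right] at h
    rw [← h, star_eq_mul]
    exact hadd _ K.longest_mem
  refine ⟨L, y, hyL, ?_, DoubleCoset.mk L.parabolic J.parabolic v, ⟨hvL.isCore_mk,
    K, s, t, hsL, htJ, hK, rfl, hLX, Set.subset_insert _ _, hmax, by rw [hmax]⟩, ?_, ?_⟩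
  · have := mt cs.length_eq_zero_iff.1 hv1
    omega
  -- The maximal elements are `y w_L` and `w_K`, with star product `y w_K`; the overlap `w_L`
  -- accounts for the difference in length.
  · rw [Coset.isReducedComp_iff, hyL.maxElt_mk, hmax, hstar, hadd _ K.longest_mem,
      hyL.length_mul_longest]
    omega
  · rw [Coset.star, hyL.maxElt_mk, hmax, hstar]
    -- `y w_K = y v w_J = x w_J` lies in `x W_J`.
    exact hx.mk_eq_iff.2 ⟨J.longest, J.longest_mem, by rw [hxyv, mul_assoc, hvK]⟩

end IsCoreElt

/-! ### The atomic subcategory -/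

namespace NilCoxeterAlgebroid

/-- The `ℤ`-linear subcategory spanned by the `∂_p` for core cosets `p`. -/
noncomputable def coreSubcategory (cs : CoxeterSystem M W) :
    LinearSubcategory (NilCoxeterAlgebroid cs) where
  hom J I := Submodule.span ℤ
    (Set.range fun p : {p : Coset (cs := cs) I J // p.IsCore} => partialHom p.1)
  id_mem I := Submodule.subset_span ⟨⟨Coset.one I, Coset.isCore_one I⟩, rfl⟩
  comp_mem {K J I f g} hf hg := by
    classical
    induction hf using Submodule.span_induction with
    | zero => rw [Limits.zero_comp]; exact zero_mem _
    | add f f' _ _ h h' => rw [Preadditive.add_comp]; exact add_mem h h'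
    | smul n f _ h => rw [Preadditive.zsmul_comp]; exact Submodule.smul_mem _ n h
    | mem f hf =>
    obtain ⟨q, rfl⟩ := hf
    induction hg using Submodule.span_induction with
    | zero => rw [Limits.comp_zero]; exact zero_mem _
    | add f f' _ _ h h' => rw [Preadditive.comp_add]; exact add_mem h h'
    | smul n f _ h => rw [Preadditive.comp_zsmul]; exact Submodule.smul_mem _ n h
    | mem g hg =>
    obtain ⟨p, rfl⟩ := hg
    dsimp only
    rw [partialHom_comp]
    split_ifs with h
    · exact Submodule.subset_span ⟨⟨_, p.2.star q.2 h⟩, rfl⟩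
    · exact zero_mem _

theorem partialHom_mem_atomicSubcategory_of_isAtomic {I J : NilCoxeterAlgebroid cs}
    {p : Coset (cs := cs) I J} (hp : p.IsAtomic) :
    partialHom p ∈ cs.atomicSubcategory.hom J I := by
  refine (Submodule.mem_sInf).2 ?_
  rintro _ ⟨A, hA, rfl⟩
  exact hA _ ⟨p, hp, rfl⟩

theorem partialHom_mk_mem_atomicSubcategory {I J : cs.FinitarySubset} {x : W}
    (hx : IsCoreElt I J x) :
    partialHom (I := I) (J := J) (DoubleCoset.mk I.parabolic J.parabolic x) ∈
      cs.atomicSubcategory.hom J I := by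
  classical
  induction hn : cs.length x using Nat.strong_induction_on generalizing I J x with
  | _ n ih =>
  by_cases hx1 : x = 1
  -- For `x = 1` conjugation is trivial, so `I = J` and the morphism is the identity.
  · subst hx1
    obtain rfl := hx.eq_of_one
    exact cs.atomicSubcategory.id_mem I
  · obtain ⟨L, y, hy, hlt, r, hr, hred, hstar⟩ := hx.exists_atomic_factorization hx1
    have h := partialHom_comp (I := I) (J := L) (K := J)
      (DoubleCoset.mk I.parabolic L.parabolic y) r
    rw [if_pos hred, hstar] at h
    rw [← h]
    exact cs.atomicSubcategory.comp_mem (partialHom_mem_atomicSubcategory_of_isAtomic hr)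
      (ih _ (hn ▸ hlt) hy rfl)

theorem atomicSubcategory_hom_eq_span (I J : NilCoxeterAlgebroid cs) :
    cs.atomicSubcategory.hom J I = Submodule.span ℤ
      (Set.range fun p : {p : Coset (cs := cs) I J // p.IsCore} => partialHom p.1) := by
  apply le_antisymm
  -- The span of core morphisms is itself a linear subcategory containing the atomic morphisms,
  -- hence one of those being intersected.
  · refine sInf_le ⟨coreSubcategory cs, ?_, rfl⟩
    rintro J I _ ⟨p, hp, rfl⟩
    exact Submodule.subset_span ⟨⟨p, hp.1⟩, rfl⟩
  · rw [Submodule.span_le]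
    rintro _ ⟨⟨p, hp⟩, rfl⟩
    have := partialHom_mk_mem_atomicSubcategory hp.isCoreElt
    exact (congrArg (fun r => partialHom r ∈ cs.atomicSubcategory.hom J I)
      (Coset.mk_minElt p)).mp this

theorem linearIndependent_partialHom (I J : NilCoxeterAlgebroid cs) :
    LinearIndependent ℤ fun p : Coset (cs := cs) I J => (partialHom p : J ⟶ I) :=
  LinearIndependent.of_comp
    -- The identity map: `J ⟶ I` is by definition the module of finitely supported functions, and
    -- the map only moves the question to that type.
    (AddMonoidHom.toIntLinearMap (AddMonoidHom.id (Coset (cs := cs) I J →₀ ℤ)) :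
      (J ⟶ I) →ₗ[ℤ] (Coset (cs := cs) I J →₀ ℤ))
    (Finsupp.linearIndependent_single_one ℤ (Coset (cs := cs) I J))

end NilCoxeterAlgebroid

end CoxeterSystem

theorem mainTheorem2 {B W : Type*} [Group W] {M : CoxeterMatrix B} (cs : CoxeterSystem M W)
    (I J : CoxeterSystem.NilCoxeterAlgebroid cs) :
    ∃ b : Module.Basis {p : CoxeterSystem.Coset (cs := cs) I J // p.IsCore} ℤ
        (cs.atomicSubcategory.hom J I),
      ∀ p, (b p : J ⟶ I) = CoxeterSystem.NilCoxeterAlgebroid.partialHom p.1 := by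
  let e := LinearEquiv.ofEq _ _
    (CoxeterSystem.NilCoxeterAlgebroid.atomicSubcategory_hom_eq_span I J).symm
  have hli := (CoxeterSystem.NilCoxeterAlgebroid.linearIndependent_partialHom I J).comp
    (fun p : {p : CoxeterSystem.Coset (cs := cs) I J // p.IsCore} => p.1) Subtype.val_injective
  refine ⟨(Module.Basis.span hli).map e, fun p => ?_⟩
  rw [Module.Basis.map_apply]
  exact congrArg Subtype.val (Module.Basis.span_apply hli p)
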